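/- Let $\mathcal L$ be an algebraic language (function symbols only). A quasivariety is a class of $\mathcal L$-algebras axiomatized by quasiequations $\Sigma\Rightarrow\varphi\approx\psi$ ($\Sigma$ a finite set of equations), and $\mathbb Q(\mathcal K)$ is the smallest quasivariety containing $\mathcal K$. For finite multisets $s,t$ of natural numbers, with $s(x)$ the number of occurrences of $x$ in $s$, write $s\le_m t$ if for every $x$ with $s(x)>t(x)$ there is $y>x$ with $t(y)>s(y)$. A finite set $\{A_1,\dots,A_n\}$ of finite $\mathcal L$-algebras ($n\ge 0$) is a minimal generating set for a quasivariety $\mathcal Q$ if $\mathbb Q(A_1,\dots,A_n)=\mathcal Q$ and $[|A_1|,\dots,|A_n|]\le_m[|B_1|,\dots,|B_k|]$ for every finite set $\{B_1,\dots,B_k\}$ of finite $\mathcal L$-algebras with $\mathbb Q(B_1,\dots,B_k)=\mathcal Q$. For a finite set $\mathcal K$ of finite $\mathcal L$-algebras, the procedure $\mathrm{MinGenSet}(\mathcal K)$ works as follows. Let $\mathcal M$ be a list of the members of $\mathcal K$, in any order, and let $i=1$. 1. While $i\le\mathrm{length}(\mathcal M)$: let $A=\mathcal M[i]$, and let $C$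 be the set of congruences of $A$ other than the diagonal $\Delta_A$. Let $S_1$ be the set of $\theta\in C$ such that $A/\theta$ embeds into $A$, and $S_2$ the set of $\theta\in C$ such that $A/\theta$ embeds into some entry of $\mathcal M$ other than $A$. If $\bigcap(S_1\cup S_2)=\Delta_A$ (where $\bigcap\emptyset=A\times A$), then append $A/\theta$ to the end of $\mathcal M$ for each $\theta\in S_1\setminus S_2$, in any order, and remove $A$ from $\mathcal M$, leaving $i$ unchanged; otherwise increase $i$ by $1$. 2. Then go once through the list $\mathcal M$ and, for each entry $A$ in turn, remove $A$ if it embeds into another entry of the current list. 3. Return the set of algebras remaining in $\mathcal M$. **Theorem.** For every finite set $\mathcal K$ of finite $\mathcal L$-algebras, every run of $\mathrm{MinGenSet}(\mathcal K)$ terminates, and every set $\mathcal R$ that it returns is a minimal generating set for $\mathbb Q(\mathcal K)$. Moreover, $\mathcal R$ is unique up to isomorphism: for every minimal generating set $\mathcal B$ for $\mathbb Q(\mathcal K)$ there is a bijection $e:\mathcal R\to\mathcal B$ with $A\cong e(A)$ for all $A\in\mathcal R$. -/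

import Mathlib

universe u v w

namespace UAlg

open FirstOrder FirstOrder.Language

/-- An `L`-algebra: a set together with an interpretation of the function symbols of `L`
(the language `L` is assumed to be algebraic, i.e. without relation symbols, wherever this
matters). -/
abbrev Alg (L : FirstOrder.Language.{u, v}) := CategoryTheory.Bundled.{w} L.Structure

/-- `A` embeds into `B`, i.e. `A ∈ IS(B)`. -/
def Embeds {L : FirstOrder.Language.{u, v}} (A B : Alg.{u, v, w} L) : Prop :=
  Nonempty (A ↪[L] B)

/-! ### Congruences and quotients -/

/-- A congruence on `A`: an equivalence relation compatible with all operations. -/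
structure Congruence {L : FirstOrder.Language.{u, v}} (A : Alg.{u, v, w} L) where
  rel : Setoid A
  compat : ∀ {n : ℕ} (f : L.Functions n) (x y : Fin n → A),
    (∀ k, rel (x k) (y k)) → rel (Structure.funMap f x) (Structure.funMap f y)

/-- The operations of `A` and the congruence `θ`, in the form from which Mathlib builds the
structure on the quotient (`f ⟦x⟧ = ⟦f x⟧`). -/
abbrev Congruence.prestructure {L : FirstOrder.Language.{u, v}} [L.IsAlgebraic] {A : Alg.{u, v, w} L}
    (θ : Congruence A) : L.Prestructure θ.rel where
  toStructure := A.str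
  fun_equiv := fun {_ f} x y h => θ.compat f x y h
  rel_equiv := fun {_ r} => isEmptyElim r

/-- The quotient algebra `A / θ`. -/
def Congruence.quotient {L : FirstOrder.Language.{u, v}} [L.IsAlgebraic] {A : Alg.{u, v, w} L}
    (θ : Congruence A) : Alg.{u, v, w} L :=
  ⟨Quotient θ.rel, @quotientStructure L A θ.rel θ.prestructure⟩

/-- The meet (intersection) of a set of congruences is the diagonal `Δ`. The meet of the empty
set of congruences is the full relation `∇`. -/
def MeetIsDiagonal {L : FirstOrder.Language.{u, v}} {A : Alg.{u, v, w} L} (S : Set (Congruence A)) : Prop :=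
  sInf (Congruence.rel '' S) = ⊥

/-! ### Quasivarieties -/

/-- An `L`-quasiequation `Σ ⇒ φ ≈ ψ`, with `Σ` a finite set of equations between terms over a
countably infinite set of variables. -/
structure Quasiequation (L : FirstOrder.Language.{u, v}) where
  premises : Finset (L.Term ℕ × L.Term ℕ)
  conclusion : L.Term ℕ × L.Term ℕ

/-- A quasiequation is valid in `A`. Homomorphisms from the term algebra to `A` are given by
assignments `h : ℕ → A` of values to the variables. -/
def Quasiequation.Valid {L : FirstOrder.Language.{u, v}} (q : Quasiequation L) (A : Alg.{u, v, w} L) : Prop :=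
  ∀ h : ℕ → A, (∀ e ∈ q.premises, e.1.realize h = e.2.realize h) →
    q.conclusion.1.realize h = q.conclusion.2.realize h

/-- A quasivariety is a class of algebras axiomatized by a set of quasiequations. -/
def IsQuasivariety {L : FirstOrder.Language.{u, v}} (C : Set (Alg.{u, v, w} L)) : Prop :=
  ∃ Λ : Set (Quasiequation L), C = {A | ∀ q ∈ Λ, q.Valid A}

/-- `Q(K)`, the smallest quasivariety containing `K`. -/
def quasivariety {L : FirstOrder.Language.{u, v}} (K : Set (Alg.{u, v, w} L)) : Set (Alg.{u, v, w} L) :=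
  ⋂₀ {C | IsQuasivariety C ∧ K ⊆ C}

theorem quasivariety_isLeast {L : FirstOrder.Language.{u, v}} (K : Set (Alg.{u, v, w} L)) :
    IsLeast {C | IsQuasivariety C ∧ K ⊆ C} (quasivariety K) := by
  refine ⟨⟨⟨{q | ∀ A ∈ K, q.Valid A}, ?_⟩, fun A hA C hC => hC.2 hA⟩,
    fun C hC => Set.sInter_subset_of_mem hC⟩
  apply Set.Subset.antisymm
  · exact Set.sInter_subset_of_mem ⟨⟨_, rfl⟩, fun A hA q hq => hq A hA⟩
  · rintro A hA C ⟨⟨Λ, rfl⟩, hK⟩ q hq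
    exact hA q fun B hB => hK hB q hq

/-! ### Minimal generating sets -/

/-- The multiset ordering `≤ₘ` on finite multisets of natural numbers: whenever `x` occurs more
often in `s` than in `t`, some `y > x` occurs more often in `t` than in `s`. -/
def MultisetLE (s t : Multiset ℕ) : Prop :=
  ∀ x, t.count x < s.count x → ∃ y, x < y ∧ s.count y < t.count y

/-- The multiset `[|A₁|, …, |Aₙ|]` of cardinalities of a finite set of finite algebras. -/
noncomputable def cardinalities {L : FirstOrder.Language.{u, v}} (K : Finset (Alg.{u, v, w} L)) :
    Multiset ℕ :=
  K.val.map fun A : Alg.{u, v, w} L => Nat.card A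

/-- `R` is a minimal generating set for the class `Q`: a finite set of finite algebras with
`Q(R) = Q`, such that the multiset of cardinalities of `R` is least among those of all finite sets
of finite algebras that generate `Q`. -/
def IsMinimalGeneratingSet {L : FirstOrder.Language.{u, v}} (R : Finset (Alg.{u, v, w} L))
    (Q : Set (Alg.{u, v, w} L)) : Prop :=
  (∀ A ∈ R, Finite A) ∧ quasivariety (R : Set (Alg.{u, v, w} L)) = Q ∧
    ∀ B : Finset (Alg.{u, v, w} L), (∀ A ∈ B, Finite A) →
      quasivariety (B : Set (Alg.{u, v, w} L)) = Q →
        MultisetLE (cardinalities R) (cardinalities B)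

/-- Two finite sets of algebras agree up to isomorphism. -/
def SameUpToIso {L : FirstOrder.Language.{u, v}} (R B : Finset (Alg.{u, v, w} L)) : Prop :=
  ∃ e : R ≃ B, ∀ A : R, Nonempty ((A : Alg.{u, v, w} L) ≃[L] (e A : Alg.{u, v, w} L))

/-! ### The procedure `MinGenSet` -/

namespace MinGenSet

/-- `S₁`: the congruences `θ ≠ Δ` of `A` such that `A / θ` embeds into `A`. -/
def S₁ {L : FirstOrder.Language.{u, v}} [L.IsAlgebraic] (A : Alg.{u, v, w} L) : Set (Congruence A) :=
  {θ | θ.rel ≠ ⊥ ∧ Embeds θ.quotient A}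

/-- `S₂`: the congruences `θ ≠ Δ` of `A` such that `A / θ` embeds into some algebra of the list
`others` (the entries of the current list other than `A`). -/
def S₂ {L : FirstOrder.Language.{u, v}} [L.IsAlgebraic] (A : Alg.{u, v, w} L)
    (others : List (Alg.{u, v, w} L)) : Set (Congruence A) :=
  {θ | θ.rel ≠ ⊥ ∧ ∃ B ∈ others, Embeds θ.quotient B}

/-- The configurations of the procedure. -/
inductive State (L : FirstOrder.Language.{u, v}) : Type (max u v (w + 1))
  /-- In the `while` loop, with current list `M` and current position `i` (counted from `0`). -/
  | loop (M : List (Alg.{u, v, w} L)) (i : ℕ)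
  /-- In the final `for` loop. The current list is `kept ++ todo`; the algebras in `todo` are
  still to be visited. -/
  | prune (kept todo : List (Alg.{u, v, w} L))
  /-- The procedure has stopped and returned the set `R`. -/
  | returned (R : Finset (Alg.{u, v, w} L))

open Classical in
/-- One step of the procedure. The entries of the list are told apart by their positions. The
order in which the new quotients are added at the end of the list is left open. -/
inductive Step {L : FirstOrder.Language.{u, v}} [L.IsAlgebraic] :
    State.{u, v, w} L → State.{u, v, w} L → Prop
  /-- If `⋂ (S₁ ∪ S₂) = Δ` for `A = M[i]`, then `A / θ` is added for every `θ ∈ S₁ \ S₂`, and `A`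
  is removed. -/
  | split (M : List (Alg.{u, v, w} L)) (i : ℕ) (hi : i < M.length)
      (hmeet : MeetIsDiagonal (S₁ M[i] ∪ S₂ M[i] (M.eraseIdx i)))
      (l : List (Congruence M[i])) (hl : l.Nodup)
      (hmem : ∀ θ, θ ∈ l ↔ θ ∈ S₁ M[i] \ S₂ M[i] (M.eraseIdx i)) :
      Step (.loop M i) (.loop (M.eraseIdx i ++ l.map Congruence.quotient) i)
  /-- If `⋂ (S₁ ∪ S₂) ≠ Δ` for `A = M[i]`, then the position is increased. -/
  | next (M : List (Alg.{u, v, w} L)) (i : ℕ) (hi : i < M.length)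
      (hmeet : ¬ MeetIsDiagonal (S₁ M[i] ∪ S₂ M[i] (M.eraseIdx i))) :
      Step (.loop M i) (.loop M (i + 1))
  /-- The `while` loop ends when the list is exhausted. -/
  | exit (M : List (Alg.{u, v, w} L)) (i : ℕ) (hi : M.length ≤ i) :
      Step (.loop M i) (.prune [] M)
  /-- `A` is removed if it embeds into another algebra of the current list. -/
  | remove (kept todo : List (Alg.{u, v, w} L)) (A : Alg.{u, v, w} L)
      (h : ∃ B ∈ kept ++ todo, Embeds A B) :
      Step (.prune kept (A :: todo)) (.prune kept todo)
  /-- `A` stays if it embeds into no other algebra of the current list. -/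
  | keep (kept todo : List (Alg.{u, v, w} L)) (A : Alg.{u, v, w} L)
      (h : ¬ ∃ B ∈ kept ++ todo, Embeds A B) :
      Step (.prune kept (A :: todo)) (.prune (kept ++ [A]) todo)
  /-- Finally, the set of the remaining algebras is returned. -/
  | ret (kept : List (Alg.{u, v, w} L)) :
      Step (.prune kept []) (.returned kept.toFinset)

/-- The initial configurations on input `K`: the list is an enumeration of `K` in any order. -/
def Initial {L : FirstOrder.Language.{u, v}} (K : Finset (Alg.{u, v, w} L)) (s : State.{u, v, w} L) : Prop :=
  ∃ M : List (Alg.{u, v, w} L), (M : Multiset (Alg.{u, v, w} L)) = K.val ∧ s = .loop M 0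

/-- `t` occurs in some run of the procedure on input `K`. -/
def Reachable {L : FirstOrder.Language.{u, v}} [L.IsAlgebraic] (K : Finset (Alg.{u, v, w} L))
    (t : State.{u, v, w} L) : Prop :=
  ∃ s, Initial K s ∧ Relation.ReflTransGen Step s t

/-- The procedure terminates on input `K`: it admits no infinite run, and a run never gets stuck
before a set has been returned. -/
def Terminates {L : FirstOrder.Language.{u, v}} [L.IsAlgebraic] (K : Finset (Alg.{u, v, w} L)) : Prop :=
  (∀ s : State.{u, v, w} L, Initial K s → Acc (fun t' t => Step t t') s) ∧
    ∀ t : State.{u, v, w} L, Reachable K t → (∃ R, t = .returned R) ∨ ∃ t', Step t t'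

/-- Some run of the procedure on input `K` returns `R`. -/
def Returns {L : FirstOrder.Language.{u, v}} [L.IsAlgebraic] (K R : Finset (Alg.{u, v, w} L)) : Prop :=
  Reachable K (.returned R)

end MinGenSet

end UAlg

/-!
Throughout, `M` is a finite set of finite algebras. The points of a finite algebra in
`quasivariety M` are separated by homomorphisms into members of `M` (`exists_hom_ne`): only
finitely many equations of its diagram are needed to exclude the finitely many maps into members of
`M` which are not homomorphisms. Conversely, separation by homomorphisms into a quasivariety implies
membership in it (`mem_quasivariety_of_separated`).

An algebra `A` is called *essential* for `M` if some pair `a ≠ b` is identified by every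
noninjective homomorphism from `A` into a member of `M`. For `A` in `M` this says exactly that the
test `⋂ (S₁ ∪ S₂) = Δ` of the procedure fails. An essential member of `M` embeds into a member of
every finite set `B` of finite algebras with `quasivariety B = quasivariety M`
(`Essential.exists_embeds`): some homomorphism from `A` into a member of `B`, followed by some
homomorphism back into a member of `M`, still separates `a` from `b`, so the composite is injective.

If the members of `R` are essential for `R` and none embeds into another, these embeddings
yield a map from `R` into any generating set `B` which does not decrease cardinalities, and which is
injective where it preserves them. A downward induction on cardinalities then gives
`[|R|] ≤ₘ [|B|]`, and if the two multisets are equal, the map is a bijection between isomorphic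
algebras (`IsEssentialAntichain.isMinimalGeneratingSet`, `IsEssentialAntichain.sameUpToIso`).

The procedure returns such an `R`. Its steps do not change the generated quasivariety, and an entry
once found essential remains so, since every entry added later embeds into one already
present. The final loop removes entries that embed into others. It terminates because replacing a
finite algebra by finitely many proper quotients decreases the multiset of cardinalities in a
well-founded order.
-/

namespace UAlg

open FirstOrder FirstOrder.Language FirstOrder.Language.Structure

variable {L : FirstOrder.Language.{u, v}}

/-! ### Embeddings and congruences -/

theorem Embeds.trans {A B C : Alg.{u, v, w} L} (h : Embeds A B) (h' : Embeds B C) :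
    Embeds A C :=
  ⟨h'.some.comp h.some⟩

theorem Embeds.card_le {A B : Alg.{u, v, w} L} [Finite B] (h : Embeds A B) :
    Nat.card A ≤ Nat.card B :=
  Nat.card_le_card_of_injective _ h.some.injective

theorem Embeds.nonempty_equiv {A B : Alg.{u, v, w} L} [Finite B] (h : Embeds A B)
    (hc : Nat.card A = Nat.card B) : Nonempty (A ≃[L] B) := by
  obtain ⟨g⟩ := h
  have hb : Function.Bijective g := g.injective.bijective_of_nat_card_le hc.ge
  exact ⟨{ Equiv.ofBijective g hb with
    map_fun' := fun f x => g.map_fun f x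
    map_rel' := fun r x => g.map_rel r x }⟩

theorem Congruence.rel_injective {A : Alg.{u, v, w} L} :
    Function.Injective (Congruence.rel : Congruence A → Setoid A) := by
  rintro ⟨r, h⟩ ⟨s, h'⟩ rfl
  rfl

theorem meetIsDiagonal_iff {A : Alg.{u, v, w} L} {S : Set (Congruence A)} :
    MeetIsDiagonal S ↔ ∀ a b : A, a ≠ b → ∃ θ ∈ S, ¬ θ.rel a b := by
  constructor
  · intro h a b hab
    by_contra! hc
    have : sInf (Congruence.rel '' S) a b := by
      rintro _ ⟨θ, hθ, rfl⟩
      exact hc θ hθ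
    rw [show sInf (Congruence.rel '' S) = ⊥ from h] at this
    exact hab this
  · intro h
    refine eq_bot_iff.2 fun a b hab => ?_
    by_contra hne
    obtain ⟨θ, hθ, hr⟩ := h a b hne
    exact hr (hab _ ⟨θ, hθ, rfl⟩)

/-! ### Quasivarieties -/

theorem mem_quasivariety_iff {K : Set (Alg.{u, v, w} L)} {A : Alg.{u, v, w} L} :
    A ∈ quasivariety K ↔ ∀ q : Quasiequation L, (∀ B ∈ K, q.Valid B) → q.Valid A := by
  constructor
  · intro h q hq
    exact h {C | ∀ p ∈ ({q} : Set (Quasiequation L)), p.Valid C}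
      ⟨⟨_, rfl⟩, fun B hB p hp => hp ▸ hq B hB⟩ q rfl
  · rintro h C ⟨⟨Λ, rfl⟩, hK⟩ q hq
    exact h q fun B hB => hK hB q hq

theorem subset_quasivariety (K : Set (Alg.{u, v, w} L)) : K ⊆ quasivariety K :=
  (quasivariety_isLeast K).1.2

theorem quasivariety_subset {K K' : Set (Alg.{u, v, w} L)} (h : K ⊆ quasivariety K') :
    quasivariety K ⊆ quasivariety K' :=
  (quasivariety_isLeast K).2 ⟨(quasivariety_isLeast K').1.1, h⟩

/-- An algebra whose points are separated by homomorphisms into a quasivariety belongs to it. -/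
theorem mem_quasivariety_of_separated {K : Set (Alg.{u, v, w} L)} {A : Alg.{u, v, w} L}
    (h : ∀ a b : A, a ≠ b → ∃ B ∈ quasivariety K, ∃ g : A →[L] B, g a ≠ g b) :
    A ∈ quasivariety K := by
  refine mem_quasivariety_iff.2 fun q hq x hx => ?_
  by_contra hne
  obtain ⟨B, hB, g, hg⟩ := h _ _ hne
  refine hg ?_
  have := mem_quasivariety_iff.1 hB q hq (g ∘ x) fun e he => by
    simp only [HomClass.realize_term, hx e he]
  simpa only [HomClass.realize_term] using this

theorem mem_quasivariety_of_embeds {K : Set (Alg.{u, v, w} L)} {A B : Alg.{u, v, w} L}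
    (hB : B ∈ quasivariety K) (h : Embeds A B) : A ∈ quasivariety K :=
  mem_quasivariety_of_separated fun _ _ hab =>
    ⟨B, hB, h.some.toHom, fun e => hab (h.some.injective e)⟩

/-! ### Essential algebras -/

/-- `A` is essential for the class `M` if some pair of distinct elements of `A` is identified by
every homomorphism from `A` into a member of `M` that is not injective. -/
def Essential (M : Set (Alg.{u, v, w} L)) (A : Alg.{u, v, w} L) : Prop :=
  ∃ a b : A, a ≠ b ∧ ∀ C ∈ M, ∀ g : A →[L] C, g a ≠ g b → Function.Injective g

/-- Being essential persists when the algebras of `M` are replaced by subalgebras. -/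
theorem Essential.anti {M M' : Set (Alg.{u, v, w} L)} {A : Alg.{u, v, w} L}
    (h : Essential M A) (hM : ∀ C ∈ M', ∃ D ∈ M, Embeds C D) : Essential M' A := by
  obtain ⟨a, b, hab, h⟩ := h
  refine ⟨a, b, hab, fun C hC g hg => ?_⟩
  obtain ⟨D, hD, ⟨e⟩⟩ := hM C hC
  exact Function.Injective.of_comp
    (h D hD (e.toHom.comp g) fun h' => hg (e.injective h') : Function.Injective (e ∘ g))

variable [L.IsAlgebraic]

/-! ### Quotient algebras -/

/-- The canonical projection onto a quotient algebra. -/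
def Congruence.proj {A : Alg.{u, v, w} L} (θ : Congruence A) : A →[L] θ.quotient where
  toFun a := Quotient.mk θ.rel a
  map_fun' f x := (@funMap_quotient_mk' L A θ.rel θ.prestructure _ f x).symm
  map_rel' r := isEmptyElim r

theorem Congruence.proj_surjective {A : Alg.{u, v, w} L} (θ : Congruence A) :
    Function.Surjective θ.proj :=
  Quotient.mk_surjective

theorem Congruence.proj_eq_iff {A : Alg.{u, v, w} L} (θ : Congruence A) {a b : A} :
    θ.proj a = θ.proj b ↔ θ.rel a b :=
  Quotient.eq (r := θ.rel)

/-- The kernel of a homomorphism. -/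
def Congruence.ker {A C : Alg.{u, v, w} L} (g : A →[L] C) : Congruence A where
  rel := Setoid.ker g
  compat f x y h := by
    have h' : g ∘ x = g ∘ y := funext h
    simp [Setoid.ker_def, h']

theorem Congruence.ker_quotient_embeds {A C : Alg.{u, v, w} L} (g : A →[L] C) :
    Embeds (Congruence.ker g).quotient C := by
  let k : (Congruence.ker g).quotient →[L] C :=
    { toFun := Quotient.lift g fun _ _ h => h
      map_fun' := fun f x => by
        obtain ⟨y, rfl⟩ : ∃ y : _ → A, x = (Congruence.ker g).proj ∘ y :=
          ⟨fun i => ((Congruence.ker g).proj_surjective (x i)).choose,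
            funext fun i => ((Congruence.ker g).proj_surjective (x i)).choose_spec.symm⟩
        rw [← (Congruence.ker g).proj.map_fun]
        exact g.map_fun f y
      map_rel' := fun r => isEmptyElim r }
  have hk : Function.Injective k := by
    intro x y h
    obtain ⟨a, rfl⟩ := (Congruence.ker g).proj_surjective x
    obtain ⟨b, rfl⟩ := (Congruence.ker g).proj_surjective y
    exact (Congruence.proj_eq_iff _).2 h
  exact ⟨Embedding.ofInjective hk⟩

theorem Congruence.finite_quotient {A : Alg.{u, v, w} L} [Finite A] (θ : Congruence A) :
    Finite θ.quotient :=
  Finite.of_surjective _ θ.proj_surjective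

theorem Congruence.card_quotient_lt {A : Alg.{u, v, w} L} [Finite A] (θ : Congruence A)
    (h : θ.rel ≠ ⊥) : Nat.card θ.quotient < Nat.card A := by
  refine lt_of_le_of_ne (Nat.card_le_card_of_surjective _ θ.proj_surjective) fun hc => h ?_
  have hb : Function.Bijective θ.proj := θ.proj_surjective.bijective_of_nat_card_le hc.ge
  ext a b
  rw [← θ.proj_eq_iff, hb.1.eq_iff]
  rfl

instance Congruence.instFinite {A : Alg.{u, v, w} L} [Finite A] : Finite (Congruence A) :=
  have : Finite (Setoid A) :=
    Finite.of_injective (fun r : Setoid A => (r : A → A → Prop)) fun _ _ h =>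
      Setoid.ext fun a b => iff_of_eq (congrFun (congrFun h a) b)
  Finite.of_injective _ Congruence.rel_injective

/-! ### Separating homomorphisms in a finitely generated quasivariety -/

/-- If `K` is a finite set of finite algebras, then the points of a finite algebra in
`quasivariety K` are separated by homomorphisms into members of `K`. Only finitely many maps from
`A` into members of `K` fail to be homomorphisms, so finitely many equations from the diagram of
`A` exclude all of them; if no homomorphism separated `a` and `b`, then these equations would
imply `a ≈ b` throughout `K`, hence in `A`. -/
theorem exists_hom_ne {K : Set (Alg.{u, v, w} L)} (hK : K.Finite) (hf : ∀ B ∈ K, Finite B)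
    {A : Alg.{u, v, w} L} [Finite A] (hA : A ∈ quasivariety K) {a b : A} (hab : a ≠ b) :
    ∃ B ∈ K, ∃ g : A →[L] B, g a ≠ g b := by
  classical
  by_contra! hno
  have : Nonempty A := ⟨a⟩
  -- The element `x` of `A` is represented by the variable `c x`.
  obtain ⟨c, hc⟩ := Countable.exists_injective_nat A
  have : Finite K := hK
  have : ∀ B : K, Finite B.1 := fun B => hf B.1 B.2
  let Bad := {p : Σ B : K, A → B.1 //
    ¬ ∀ (n : ℕ) (f : L.Functions n) (x : Fin n → A), p.2 (funMap f x) = funMap f (p.2 ∘ x)}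
  have hbad : ∀ p : Bad, ∃ (n : ℕ) (f : L.Functions n) (x : Fin n → A),
      p.1.2 (funMap f x) ≠ funMap f (p.1.2 ∘ x) := fun p => by
    have := p.2
    push Not at this
    exact this
  choose n f x hx using hbad
  let eqn : Bad → L.Term ℕ × L.Term ℕ := fun p =>
    (Term.func (f p) fun i => Term.var (c (x p i)), Term.var (c (funMap (f p) (x p))))
  let q : Quasiequation L :=
    ⟨(Set.finite_range eqn).toFinset, (Term.var (c a), Term.var (c b))⟩
  have hq : ∀ B ∈ K, q.Valid B := by
    intro B hB h hprem
    by_cases hg : ∀ (n : ℕ) (f : L.Functions n) (x : Fin n → A),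
        (h ∘ c) (funMap f x) = funMap f ((h ∘ c) ∘ x)
    · exact hno B hB ⟨h ∘ c, fun f x => hg _ f x, fun r => isEmptyElim r⟩
    · let p : Bad := ⟨⟨⟨B, hB⟩, h ∘ c⟩, hg⟩
      exact absurd (hprem (eqn p) (by simp [q])).symm (hx p)
  refine hab ?_
  have := mem_quasivariety_iff.1 hA q hq (Function.invFun c) fun e he => by
    obtain ⟨p, rfl⟩ := (Set.Finite.mem_toFinset _).1 he
    simp [eqn, Function.leftInverse_invFun hc _]
  simpa [q, Function.leftInverse_invFun hc _] using this

/-- An essential algebra embeds into a member of any finite generating set of finite algebras: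
follow a homomorphism into the generating set that separates the critical pair by one back into
`M` that still separates it; the composite is injective. -/
theorem Essential.exists_embeds {M B : Set (Alg.{u, v, w} L)} {A : Alg.{u, v, w} L} [Finite A]
    (h : Essential M A) (hA : A ∈ quasivariety B)
    (hM : M.Finite) (hMf : ∀ C ∈ M, Finite C) (hB : B.Finite) (hBf : ∀ C ∈ B, Finite C)
    (hBM : B ⊆ quasivariety M) : ∃ C ∈ B, Embeds A C := by
  obtain ⟨a, b, hab, h⟩ := h
  obtain ⟨C, hC, g, hg⟩ := exists_hom_ne hB hBf hA hab
  have := hBf C hC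
  obtain ⟨D, hD, k, hk⟩ := exists_hom_ne hM hMf (hBM hC) hg
  have hinj : Function.Injective (k ∘ g) := h D hD (k.comp g) hk
  exact ⟨C, hC, ⟨Embedding.ofInjective hinj.of_comp⟩⟩

/-! ### Comparison of multisets -/

section Multisets

theorem MultisetLE.antisymm {s t : Multiset ℕ} (h : MultisetLE s t) (h' : MultisetLE t s) :
    s = t := by
  classical
  by_contra hne
  let F := (s + t).toFinset.filter fun x => s.count x ≠ t.count x
  have hF : ∀ x, s.count x ≠ t.count x → x ∈ F := fun x hx => by
    simp only [F, Finset.mem_filter, Multiset.mem_toFinset, Multiset.mem_add]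
    refine ⟨?_, hx⟩
    by_contra! hc
    simp [Multiset.count_eq_zero_of_notMem hc.1, Multiset.count_eq_zero_of_notMem hc.2] at hx
  obtain ⟨x, hx⟩ : ∃ x, s.count x ≠ t.count x := by
    by_contra! hc
    exact hne (Multiset.ext.2 hc)
  obtain ⟨m, hm, hmax⟩ := F.exists_max_image id ⟨x, hF x hx⟩
  obtain hlt | hlt := lt_or_gt_of_ne (Finset.mem_filter.1 hm).2
  · obtain ⟨y, hy, hy'⟩ := h' m hlt
    exact absurd (hmax y (hF y hy'.ne')) (not_le.2 hy)
  · obtain ⟨y, hy, hy'⟩ := h m hlt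
    exact absurd (hmax y (hF y hy'.ne)) (not_le.2 hy)

variable {α : Type*} {size : α → ℕ} {R B : Finset α} {f : α → α}

theorem count_map_size (R : Finset α) (size : α → ℕ) (x : ℕ) :
    (R.val.map size).count x = (R.filter fun A => size A = x).card := by
  classical
  rw [Multiset.count_map, Finset.card_def, Finset.filter_val]
  simp only [eq_comm]

/-- Let `f : R → B` be a map that does not decrease sizes and in which an element whose size is
preserved shares its image with no other element. If above `x` every size occurs at most as often
in `B` as in `R`, then `f` preserves all sizes from `x` on. -/
theorem size_map_eq (hf : ∀ A ∈ R, f A ∈ B) (hle : ∀ A ∈ R, size A ≤ size (f A))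
    (hinj : ∀ A ∈ R, ∀ A' ∈ R, size (f A) = size A → f A' = f A → A' = A) {x : ℕ}
    (hx : ∀ y, x < y → (B.val.map size).count y ≤ (R.val.map size).count y) :
    ∀ A ∈ R, x ≤ size A → size (f A) = size A := by
  classical
  by_contra! hc
  obtain ⟨A₀, hA₀, hxA₀, hne₀⟩ := hc
  obtain ⟨A, hA, hmax⟩ := (R.filter fun A => x ≤ size A ∧ size (f A) ≠ size A).exists_max_image
    size ⟨A₀, by simp [hA₀, hxA₀, hne₀]⟩
  obtain ⟨hA, hxA, hne⟩ := Finset.mem_filter.1 hA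
  have hlt : size A < size (f A) := lt_of_le_of_ne (hle A hA) hne.symm
  -- By maximality `f` preserves the size `z` of `f A`; hence it maps the elements of size `z` in
  -- `R` onto those in `B`, one of which is `f A`.
  have hz : ∀ A' ∈ R, size A' = size (f A) → size (f A') = size A' := fun A' hA' hs => by
    by_contra hne'
    have := hmax A' (Finset.mem_filter.2 ⟨hA', by omega, hne'⟩)
    omega
  have himg : (R.filter fun A' => size A' = size (f A)).image f =
      B.filter fun A' => size A' = size (f A) := by
    refine Finset.eq_of_subset_of_card_le ?_ ?_
    · intro C hC
      obtain ⟨A', hA', rfl⟩ := Finset.mem_image.1 hC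
      obtain ⟨hA', hs⟩ := Finset.mem_filter.1 hA'
      exact Finset.mem_filter.2 ⟨hf A' hA', (hz A' hA' hs).trans hs⟩
    · rw [Finset.card_image_of_injOn, ← count_map_size, ← count_map_size]
      · exact hx _ (hxA.trans_lt hlt)
      · intro A₁ h₁ A₂ h₂ h
        obtain ⟨h₁, -⟩ := Finset.mem_filter.1 h₁
        obtain ⟨h₂, hs⟩ := Finset.mem_filter.1 h₂
        exact hinj A₂ h₂ A₁ h₁ (hz A₂ h₂ hs) h
  have hmem : f A ∈ (R.filter fun A' => size A' = size (f A)).image f := by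
    rw [himg]
    exact Finset.mem_filter.2 ⟨hf A hA, rfl⟩
  obtain ⟨A', hA', hfA'⟩ := Finset.mem_image.1 hmem
  obtain ⟨hA', hs⟩ := Finset.mem_filter.1 hA'
  have := hinj A' hA' A hA (hz A' hA' hs) hfA'.symm
  subst this
  omega

theorem multisetLE_map_size (hf : ∀ A ∈ R, f A ∈ B) (hle : ∀ A ∈ R, size A ≤ size (f A))
    (hinj : ∀ A ∈ R, ∀ A' ∈ R, size (f A) = size A → f A' = f A → A' = A) :
    MultisetLE (R.val.map size) (B.val.map size) := by
  intro x hx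
  by_contra! hc
  have hs := size_map_eq hf hle hinj hc
  refine absurd hx (not_lt.2 ?_)
  rw [count_map_size, count_map_size]
  refine Finset.card_le_card_of_injOn f ?_ ?_
  · intro A hA
    obtain ⟨hA, hAx⟩ := Finset.mem_filter.1 hA
    exact Finset.mem_filter.2 ⟨hf A hA, (hs A hA hAx.ge).trans hAx⟩
  · intro A₁ h₁ A₂ h₂ h
    obtain ⟨h₁, -⟩ := Finset.mem_filter.1 h₁
    obtain ⟨h₂, hx₂⟩ := Finset.mem_filter.1 h₂
    exact hinj A₂ h₂ A₁ h₁ (hs A₂ h₂ hx₂.ge) h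

end Multisets

/-! ### Essential antichains are minimal generating sets -/

/-- `R` is a finite set of finite algebras, each essential for `R`, none of which embeds into
another. -/
structure IsEssentialAntichain (R : Finset (Alg.{u, v, w} L)) : Prop where
  finite : ∀ A ∈ R, Finite A
  essential : ∀ A ∈ R, Essential (R : Set (Alg.{u, v, w} L)) A
  eq_of_embeds : ∀ A ∈ R, ∀ B ∈ R, Embeds A B → A = B

namespace IsEssentialAntichain

variable {R B : Finset (Alg.{u, v, w} L)}

/-- The members of `R` embed into members of any other generating set `B`. A member of `B` of the
same cardinality as a member of `R` embedded into it is isomorphic to it, and so, `R` being an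
antichain, receives no other member of `R`. -/
theorem exists_map (hR : IsEssentialAntichain R) (hB : ∀ A ∈ B, Finite A)
    (h : quasivariety (B : Set (Alg.{u, v, w} L)) = quasivariety (R : Set (Alg.{u, v, w} L))) :
    ∃ f : Alg.{u, v, w} L → Alg.{u, v, w} L, (∀ A ∈ R, f A ∈ B) ∧ (∀ A ∈ R, Embeds A (f A)) ∧
      (∀ A ∈ R, Nat.card A ≤ Nat.card (f A)) ∧
      ∀ A ∈ R, ∀ A' ∈ R, Nat.card (f A) = Nat.card A → f A' = f A → A' = A := by
  have key : ∀ A : Alg.{u, v, w} L, ∃ C : Alg.{u, v, w} L, A ∈ R → C ∈ B ∧ Embeds A C := by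
    intro A
    by_cases hA : A ∈ R
    · have := hR.finite A hA
      obtain ⟨C, hC, hAC⟩ := (hR.essential A hA).exists_embeds
        (h ▸ subset_quasivariety _ hA) R.finite_toSet hR.finite B.finite_toSet hB
        (h ▸ subset_quasivariety _)
      exact ⟨C, fun _ => ⟨hC, hAC⟩⟩
    · exact ⟨A, fun h => absurd h hA⟩
  choose f hf using key
  refine ⟨f, fun A hA => (hf A hA).1, fun A hA => (hf A hA).2, fun A hA => ?_, ?_⟩
  · have := hB _ (hf A hA).1
    exact (hf A hA).2.card_le
  · intro A hA A' hA' hc he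
    have := hB _ (hf A hA).1
    obtain ⟨i⟩ := (hf A hA).2.nonempty_equiv hc.symm
    refine hR.eq_of_embeds A' hA' A hA (Embeds.trans (B := f A) ?_ ⟨i.symm.toEmbedding⟩)
    exact he ▸ (hf A' hA').2

theorem isMinimalGeneratingSet (hR : IsEssentialAntichain R) {Q : Set (Alg.{u, v, w} L)}
    (hQ : quasivariety (R : Set (Alg.{u, v, w} L)) = Q) : IsMinimalGeneratingSet R Q := by
  refine ⟨hR.finite, hQ, fun B hB h => ?_⟩
  obtain ⟨f, hf, -, hle, hinj⟩ := hR.exists_map hB (h.trans hQ.symm)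
  exact multisetLE_map_size hf hle hinj

theorem sameUpToIso (hR : IsEssentialAntichain R) {Q : Set (Alg.{u, v, w} L)}
    (hQ : quasivariety (R : Set (Alg.{u, v, w} L)) = Q) (hB : IsMinimalGeneratingSet B Q) :
    SameUpToIso R B := by
  obtain ⟨f, hf, hemb, hle, hinj⟩ := hR.exists_map hB.1 (hB.2.1.trans hQ.symm)
  have heq : cardinalities R = cardinalities B :=
    ((hR.isMinimalGeneratingSet hQ).2.2 B hB.1 hB.2.1).antisymm (hB.2.2 R hR.finite hQ)
  have hs : ∀ A ∈ R, Nat.card (f A) = Nat.card A := fun A hA =>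
    size_map_eq (x := 0) (size := fun A : Alg.{u, v, w} L => Nat.card A) hf hle hinj
      (fun y _ => (congrArg (Multiset.count y) heq).ge) A hA (Nat.zero_le _)
  have hcard : R.card = B.card := by
    simpa [cardinalities] using congrArg Multiset.card heq
  let g : R → B := fun A => ⟨f A, hf A A.2⟩
  have hg : Function.Injective g := fun A₁ A₂ h =>
    Subtype.ext (hinj A₂ A₂.2 A₁ A₁.2 (hs A₂ A₂.2) (congrArg Subtype.val h))
  have hg' : Function.Bijective g := by
    rw [Fintype.bijective_iff_injective_and_card]
    exact ⟨hg, by simpa using hcard⟩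
  refine ⟨Equiv.ofBijective g hg', fun A => ?_⟩
  have := hB.1 _ (hf A A.2)
  exact (hemb A A.2).nonempty_equiv (hs A A.2).symm

end IsEssentialAntichain

/-! ### The procedure -/

namespace MinGenSet

/-- The entries which the `while` loop leaves in place are essential for the current list. -/
theorem essential_of_not_meetIsDiagonal {M : List (Alg.{u, v, w} L)} {i : ℕ} (hi : i < M.length)
    (h : ¬ MeetIsDiagonal (S₁ M[i] ∪ S₂ M[i] (M.eraseIdx i))) :
    Essential {C | C ∈ M} M[i] := by
  rw [meetIsDiagonal_iff] at h
  push Not at h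
  obtain ⟨a, b, hab, h⟩ := h
  refine ⟨a, b, hab, fun C hC g hg => ?_⟩
  by_contra hinj
  refine hg (h (Congruence.ker g) ?_)
  have hker : (Congruence.ker g).rel ≠ ⊥ := fun hbot =>
    hinj (Setoid.injective_iff_ker_bot g |>.2 hbot)
  have hC' : C ∈ M[i] :: M.eraseIdx i := (List.getElem_cons_eraseIdx_perm hi).mem_iff.2 hC
  obtain rfl | hC' := List.mem_cons.1 hC'
  · exact Or.inl ⟨hker, Congruence.ker_quotient_embeds g⟩
  · exact Or.inr ⟨hker, C, hC', Congruence.ker_quotient_embeds g⟩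

/-- Replacing `M[i]` by quotients preserves the generated quasivariety: the new entries embed into
`M[i]`, and the points of `M[i]` are separated by its projections onto quotients which are new
entries or embed into old ones. -/
theorem quasivariety_split {M : List (Alg.{u, v, w} L)} {i : ℕ} (hi : i < M.length)
    (hmeet : MeetIsDiagonal (S₁ M[i] ∪ S₂ M[i] (M.eraseIdx i)))
    {l : List (Congruence M[i])} (hmem : ∀ θ, θ ∈ l ↔ θ ∈ S₁ M[i] \ S₂ M[i] (M.eraseIdx i)) :
    quasivariety {C | C ∈ M.eraseIdx i ++ l.map Congruence.quotient} =
      quasivariety {C | C ∈ M} := by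
  apply Set.Subset.antisymm <;> apply quasivariety_subset
  · intro C hC
    obtain hC | hC := List.mem_append.1 hC
    · exact subset_quasivariety _ (List.mem_of_mem_eraseIdx hC)
    · obtain ⟨θ, hθ, rfl⟩ := List.mem_map.1 hC
      exact mem_quasivariety_of_embeds (subset_quasivariety _ (List.getElem_mem hi))
        ((hmem θ).1 hθ).1.2
  · intro C hC
    have hC' : C ∈ M[i] :: M.eraseIdx i := (List.getElem_cons_eraseIdx_perm hi).mem_iff.2 hC
    obtain rfl | hC' := List.mem_cons.1 hC'
    · refine mem_quasivariety_of_separated fun a b hab => ?_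
      obtain ⟨θ, hθ, hr⟩ := meetIsDiagonal_iff.1 hmeet a b hab
      refine ⟨θ.quotient, ?_, θ.proj, fun h => hr (θ.proj_eq_iff.1 h)⟩
      by_cases h₂ : θ ∈ S₂ M[i] (M.eraseIdx i)
      · obtain ⟨-, B, hB, hθB⟩ := h₂
        exact mem_quasivariety_of_embeds
          (subset_quasivariety _ (List.mem_append_left _ hB)) hθB
      · exact subset_quasivariety _ (List.mem_append_right _
          (List.mem_map_of_mem ((hmem θ).2 ⟨hθ.resolve_right h₂, h₂⟩)))
    · exact subset_quasivariety _ (List.mem_append_left _ hC')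

theorem finite_of_mem_split {M : List (Alg.{u, v, w} L)} (hM : ∀ A ∈ M, Finite A) {i : ℕ}
    (hi : i < M.length) (l : List (Congruence M[i])) :
    ∀ A ∈ M.eraseIdx i ++ l.map Congruence.quotient, Finite A := by
  intro A hA
  obtain hA | hA := List.mem_append.1 hA
  · exact hM A (List.mem_of_mem_eraseIdx hA)
  · obtain ⟨θ, -, rfl⟩ := List.mem_map.1 hA
    have := hM _ (List.getElem_mem hi)
    exact θ.finite_quotient

/-! ### Termination -/

theorem acc_prune (kept todo : List (Alg.{u, v, w} L)) :
    Acc (fun t' t : State.{u, v, w} L => Step t t') (.prune kept todo) := by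
  induction todo generalizing kept with
  | nil =>
    refine ⟨_, fun t h => ?_⟩
    cases h
    exact ⟨_, fun t h => nomatch h⟩
  | cons A todo ih =>
    refine ⟨_, fun t h => ?_⟩
    cases h with
    | remove => exact ih _
    | keep => exact ih _

/-- The `while` loop terminates: replacing an entry by proper quotients lowers the multiset of
cardinalities in the well-founded order in which a number may be traded for finitely many smaller
ones, and the position cannot increase forever while the list is unchanged. -/
theorem acc_loop (m : Multiset ℕ) : ∀ (M : List (Alg.{u, v, w} L)) (i : ℕ),
    (∀ A ∈ M, Finite A) → (M.map fun A : Alg.{u, v, w} L => Nat.card A : Multiset ℕ) = m →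
      Acc (fun t' t : State.{u, v, w} L => Step t t') (.loop M i) := by
  induction m using (WellFounded.cutExpand (r := (· < · : ℕ → ℕ → Prop)) wellFounded_lt).induction
    with
  | _ m ih =>
    intro M i hM hm
    induction hk : M.length - i generalizing i with
    | zero =>
      refine ⟨_, fun t h => ?_⟩
      cases h with
      | split _ _ hi => omega
      | next _ _ hi => omega
      | exit => exact acc_prune _ _
    | succ k ihk =>
      refine ⟨_, fun t h => ?_⟩
      cases h with
      | split _ _ hi hmeet l _ hmem =>
        refine ih _ ?_ _ _ (finite_of_mem_split hM hi l) rfl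
        refine ⟨((l.map fun θ => Nat.card θ.quotient : List ℕ) : Multiset ℕ), Nat.card M[i], ?_, ?_⟩
        · intro c hc
          obtain ⟨θ, hθ, rfl⟩ := List.mem_map.1 (Multiset.mem_coe.1 hc)
          have := hM _ (List.getElem_mem hi)
          exact θ.card_quotient_lt ((hmem θ).1 hθ).1.1
        · have hp := (List.getElem_cons_eraseIdx_perm hi).map
            fun A : Alg.{u, v, w} L => Nat.card A
          rw [← hm, ← Multiset.coe_eq_coe.2 hp, List.map_cons, ← Multiset.cons_coe,
            ← Multiset.singleton_add, List.map_append, List.map_map, ← Multiset.coe_add]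
          simp only [Function.comp_def]
          abel
      | next _ _ hi => exact ihk _ (by omega)
      | exit _ _ hi => omega

/-! ### Correctness -/

/-- The property of a configuration that links it to the input `K`. All algebras in it are finite
and they generate `quasivariety K`; the entries before the current position, and all entries once
the `while` loop is over, are essential for the current list; and an entry kept by the final
`for` loop embeds into no entry different from it. A returned set is an essential antichain. -/
def Invariant (K : Finset (Alg.{u, v, w} L)) : State.{u, v, w} L → Prop
  | .loop M i => (∀ A ∈ M, Finite A) ∧
      quasivariety {C | C ∈ M} = quasivariety (K : Set (Alg.{u, v, w} L)) ∧
      ∀ A ∈ M.take i, Essential {C | C ∈ M} A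
  | .prune kept todo => (∀ A ∈ kept ++ todo, Finite A) ∧
      quasivariety {C | C ∈ kept ++ todo} = quasivariety (K : Set (Alg.{u, v, w} L)) ∧
      (∀ A ∈ kept ++ todo, Essential {C | C ∈ kept ++ todo} A) ∧
      (∀ A ∈ kept, ∀ B ∈ kept ++ todo, Embeds A B → A = B)
  | .returned R => IsEssentialAntichain R ∧
      quasivariety (R : Set (Alg.{u, v, w} L)) = quasivariety (K : Set (Alg.{u, v, w} L))

theorem Invariant.step {K : Finset (Alg.{u, v, w} L)} {s t : State.{u, v, w} L}
    (hs : Invariant K s) (h : Step s t) : Invariant K t := by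
  classical
  cases h with
  | split M i hi hmeet l hl hmem =>
    obtain ⟨hfin, hQ, hess⟩ := hs
    refine ⟨finite_of_mem_split hfin hi l, (quasivariety_split hi hmeet hmem).trans hQ, ?_⟩
    intro A hA
    have htake : (M.eraseIdx i ++ l.map Congruence.quotient).take i = M.take i := by
      rw [List.take_append_of_le_length (by rw [List.length_eraseIdx_of_lt hi]; omega),
        List.take_eraseIdx_eq_take_of_le _ _ _ le_rfl]
    refine (hess A (htake ▸ hA)).anti fun C hC => ?_
    obtain hC | hC := List.mem_append.1 hC
    · exact ⟨C, List.mem_of_mem_eraseIdx hC, ⟨Embedding.refl L C⟩⟩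
    · obtain ⟨θ, hθ, rfl⟩ := List.mem_map.1 hC
      exact ⟨M[i], List.getElem_mem hi, ((hmem θ).1 hθ).1.2⟩
  | next M i hi hmeet =>
    obtain ⟨hfin, hQ, hess⟩ := hs
    refine ⟨hfin, hQ, fun A hA => ?_⟩
    rw [List.take_succ_eq_append_getElem hi] at hA
    obtain hA | hA := List.mem_append.1 hA
    · exact hess A hA
    · obtain rfl := List.mem_singleton.1 hA
      exact essential_of_not_meetIsDiagonal hi hmeet
  | exit M i hi =>
    obtain ⟨hfin, hQ, hess⟩ := hs
    rw [List.take_of_length_le hi] at hess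
    exact ⟨hfin, hQ, hess, fun A hA => absurd hA List.not_mem_nil⟩
  | remove kept todo A h =>
    obtain ⟨hfin, hQ, hess, hanti⟩ := hs
    have hsub : ∀ C ∈ kept ++ todo, C ∈ kept ++ A :: todo := fun C hC => by
      simp only [List.mem_append, List.mem_cons] at hC ⊢
      tauto
    refine ⟨fun C hC => hfin C (hsub C hC), ?_, fun C hC => (hess C (hsub C hC)).anti
      fun D hD => ⟨D, hsub D hD, ⟨Embedding.refl L D⟩⟩, fun C hC D hD => hanti C hC D (hsub D hD)⟩
    rw [← hQ]
    apply Set.Subset.antisymm <;> apply quasivariety_subset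
    · exact fun C hC => subset_quasivariety _ (hsub C hC)
    · intro C hC
      obtain ⟨B, hB, hAB⟩ := h
      have hC' : C = A ∨ C ∈ kept ++ todo := by
        simp only [Set.mem_ofPred_eq, List.mem_append, List.mem_cons] at hC ⊢
        tauto
      obtain rfl | hC' := hC'
      · exact mem_quasivariety_of_embeds (subset_quasivariety _ hB) hAB
      · exact subset_quasivariety _ hC'
  | keep kept todo A h =>
    obtain ⟨hfin, hQ, hess, hanti⟩ := hs
    rw [Invariant, List.append_assoc, List.singleton_append]
    refine ⟨hfin, hQ, hess, fun C hC D hD hCD => ?_⟩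
    obtain hC | hC := List.mem_append.1 hC
    · exact hanti C hC D hD hCD
    · obtain rfl := List.mem_singleton.1 hC
      by_contra hne
      refine h ⟨D, ?_, hCD⟩
      simp only [List.mem_append, List.mem_cons] at hD ⊢
      have := Ne.symm hne
      tauto
  | ret kept =>
    obtain ⟨hfin, hQ, hess, hanti⟩ := hs
    rw [List.append_nil] at hfin hQ hess hanti
    have hset : ((kept.toFinset : Finset (Alg.{u, v, w} L)) : Set (Alg.{u, v, w} L)) =
        {C | C ∈ kept} := by
      ext C
      simp
    refine ⟨⟨fun A hA => hfin A ?_, fun A hA => ?_, fun A hA B hB => hanti A ?_ B ?_⟩, ?_⟩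
    · simpa using hA
    · rw [hset]
      exact hess A (by simpa using hA)
    · simpa using hA
    · simpa using hB
    · rw [hset, hQ]

omit [L.IsAlgebraic] in
theorem invariant_of_initial {K : Finset (Alg.{u, v, w} L)} (hK : ∀ A ∈ K, Finite A)
    {s : State.{u, v, w} L} (hs : Initial K s) : Invariant K s := by
  obtain ⟨M, hM, rfl⟩ := hs
  have hmem : ∀ A, A ∈ M ↔ A ∈ K := fun A => by
    rw [← Finset.mem_val, ← hM, Multiset.mem_coe]
  refine ⟨fun A hA => hK A ((hmem A).1 hA), ?_, fun A hA => ?_⟩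
  · congr 1
    ext A
    exact hmem A
  · simp at hA

theorem invariant_of_reachable {K : Finset (Alg.{u, v, w} L)} (hK : ∀ A ∈ K, Finite A)
    {t : State.{u, v, w} L} (ht : Reachable K t) : Invariant K t := by
  obtain ⟨s, hs, hst⟩ := ht
  induction hst with
  | refl => exact invariant_of_initial hK hs
  | tail _ h ih => exact ih.step h

/-- A configuration of finite algebras in which no set has been returned admits a step. The
finiteness of `M[i]` is needed to enumerate the congruences in `S₁ \ S₂`. -/
theorem Invariant.returned_or_step {K : Finset (Alg.{u, v, w} L)} {t : State.{u, v, w} L}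
    (ht : Invariant K t) : (∃ R, t = .returned R) ∨ ∃ t', Step t t' := by
  classical
  cases t with
  | loop M i =>
    refine Or.inr ?_
    by_cases hi : i < M.length
    · by_cases hmeet : MeetIsDiagonal (S₁ M[i] ∪ S₂ M[i] (M.eraseIdx i))
      · have := ht.1 _ (List.getElem_mem hi)
        have hfin := Set.toFinite (S₁ M[i] \ S₂ M[i] (M.eraseIdx i))
        exact ⟨_, .split M i hi hmeet hfin.toFinset.toList (Finset.nodup_toList _)
          fun θ => by rw [Finset.mem_toList, Set.Finite.mem_toFinset]⟩
      · exact ⟨_, .next M i hi hmeet⟩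
    · exact ⟨_, .exit M i (not_lt.1 hi)⟩
  | prune kept todo =>
    refine Or.inr ?_
    cases todo with
    | nil => exact ⟨_, .ret kept⟩
    | cons A todo =>
      by_cases h : ∃ B ∈ kept ++ todo, Embeds A B
      · exact ⟨_, .remove kept todo A h⟩
      · exact ⟨_, .keep kept todo A h⟩
  | returned R => exact Or.inl ⟨R, rfl⟩

theorem terminates {K : Finset (Alg.{u, v, w} L)} (hK : ∀ A ∈ K, Finite A) : Terminates K := by
  refine ⟨fun s hs => ?_, fun t ht => (invariant_of_reachable hK ht).returned_or_step⟩
  have hinv := invariant_of_initial hK hs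
  obtain ⟨M, -, rfl⟩ := hs
  exact acc_loop _ M 0 hinv.1 rfl

end MinGenSet

end UAlg

theorem mainTheorem2 {L : FirstOrder.Language.{u, v}} [L.IsAlgebraic]
    (K : Finset (UAlg.Alg.{u, v, w} L)) (hK : ∀ A ∈ K, Finite A) :
    UAlg.MinGenSet.Terminates K ∧
      ∀ R : Finset (UAlg.Alg.{u, v, w} L), UAlg.MinGenSet.Returns K R →
        UAlg.IsMinimalGeneratingSet R
            (UAlg.quasivariety (K : Set (UAlg.Alg.{u, v, w} L))) ∧
          ∀ B : Finset (UAlg.Alg.{u, v, w} L),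
            UAlg.IsMinimalGeneratingSet B
                (UAlg.quasivariety (K : Set (UAlg.Alg.{u, v, w} L))) →
              UAlg.SameUpToIso R B := by
  refine ⟨UAlg.MinGenSet.terminates hK, fun R hR => ?_⟩
  obtain ⟨hanti, hQ⟩ : UAlg.IsEssentialAntichain R ∧ _ :=
    UAlg.MinGenSet.invariant_of_reachable hK hR
  exact ⟨hanti.isMinimalGeneratingSet hQ, fun B hB => hanti.sameUpToIso hQ hB⟩
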